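/- Let $G=(V,E)$ be a finite strongly connected digraph, let $s\in V$ be an arbitrary start vertex, and let $G^R$ be the digraph obtained by reversing all edges of $G$. For a vertex $u$, let $G\setminus u$ be $G$ with $u$ and its incident edges deleted; $u$ is a strong articulation point of $G$ if $G\setminus u$ has more strongly connected components than $G$. Components are identified with their vertex sets. A vertex $u$ dominates $v$ in the flow graph $G_s$ ($G$ with start vertex $s$) if every path from $s$ to $v$ in $G$ contains $u$; $u$ is a nontrivial dominator of $G_s$ if $u\neq s$ and $u$ dominates some $v\neq u$. The dominator tree $D$ of $G_s$ has root $s$, and the parent of $v\neq s$ is its immediate dominator, i.e. the dominator of $v$ different from $v$ that is dominated by every dominator of $v$ different from $v$. $D(u)$ denotes the set of descendants of $u$ in $D$ (including $u$), and $\widetilde D(u)=D(u)\setminus\{u\}$. Let $T$ be a depth-first search tree of $G$ with start vertex $s$. For $v\in V$ let $\mathrm{loop}(v)$ be the set of descendants $x$ of $v$ in $T$ such that $G$ has a path from $x$ to $v$ containing only descendants of $v$ in $T$. The loop nesting tree $H$ of $G_s$ with respect to $T$ is the rooted tree in which the parent $h(v)$ of $v$ is the nearest proper ancestor $p$ of $v$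 in $T$ with $v\in\mathrm{loop}(p)$ (if there is one); $H(w)$ is the set of descendants of $w$ in $H$ (including $w$). Denote by $D^R,\widetilde D^R,H^R,h^R$ the same objects for $G^R$ with start vertex $s$, where $H^R$ is taken with respect to a depth-first search tree of $G^R$ with start vertex $s$. Theorem. Let $u$ be a strong articulation point of $G$ and let $C$ be a strongly connected component of $G\setminus u$. Then the hypothesis of one of the following cases is satisfied, and in each case the stated conclusion holds. (a) If $u$ is a nontrivial dominator in $G_s$ but not in $G_s^R$, then $C\subseteq\widetilde D(u)$ or $C=V\setminus D(u)$. (b) If $u$ is a nontrivial dominator in $G_s^R$ but not in $G_s$, then $C\subseteq\widetilde D^R(u)$ or $C=V\setminus D^R(u)$. (c) If $u$ is a nontrivial dominator in both $G_s$ and $G_s^R$, then $C\subseteq\widetilde D(u)\setminus\widetilde D^R(u)$, or $C\subseteq\widetilde D^R(u)\setminus\widetilde D(u)$, or $C\subseteq\widetilde D(u)\cap\widetilde D^R(u)$, or $C=V\setminus(D(u)\cup D^R(u))$. (d) If $u=s$, then $C\subseteq\widetilde D(u)$. Moreover, if $C\subseteq\widetilde D(u)$, then $C=H(w)$ for some vertex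 $w\in\widetilde D(u)$ whose parent $h(w)$ exists and satisfies $h(w)\notin\widetilde D(u)$; and if $C\subseteq\widetilde D^R(u)$, then $C=H^R(w)$ for some $w\in\widetilde D^R(u)$ whose parent $h^R(w)$ exists and satisfies $h^R(w)\notin\widetilde D^R(u)$. -/

import Mathlib

namespace Digraph

variable {V : Type*}

/-- The reverse digraph `G^R`: every edge is reversed. -/
def reverse (G : Digraph V) : Digraph V where
  Adj x y := G.Adj y x

/-- The digraph `G ∖ u` obtained by deleting the vertex `u` with all its incident edges. -/
def deleteVertex (G : Digraph V) (u : V) : Digraph {v : V // v ≠ u} where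
  Adj x y := G.Adj x.1 y.1

/-- The list `p` is the sequence of vertices of a (directed) path from `x` to `y` in `G`.
Vertices may repeat, and the one-vertex list is a path from a vertex to itself. -/
def IsPath (G : Digraph V) (x y : V) (p : List V) : Prop :=
  p.IsChain G.Adj ∧ p.head? = some x ∧ p.getLast? = some y

/-- There is a path from `x` to `y` in `G` all of whose vertices lie in `S`. -/
def ReachesWithin (G : Digraph V) (S : Set V) (x y : V) : Prop :=
  ∃ p : List V, G.IsPath x y p ∧ ∀ v ∈ p, v ∈ S

/-- `G` is strongly connected: every vertex reaches every vertex. -/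
def StronglyConnected (G : Digraph V) : Prop :=
  ∀ x y : V, ∃ p : List V, G.IsPath x y p

/-- `C` is (the vertex set of) a strongly connected component of `G`: a maximal nonempty set of
vertices that induces a strongly connected subgraph. -/
def IsSCC (G : Digraph V) (C : Set V) : Prop :=
  Maximal (fun S : Set V => S.Nonempty ∧ ∀ x ∈ S, ∀ y ∈ S, G.ReachesWithin S x y) C

/-- The number of strongly connected components (of a finite digraph). -/
noncomputable def numSCC (G : Digraph V) : ℕ :=
  {C : Set V | G.IsSCC C}.ncard

/-- `u` is a strong articulation point: its removal increases the number of strongly connected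
components. -/
def IsStrongArticulationPoint (G : Digraph V) (u : V) : Prop :=
  G.numSCC < (G.deleteVertex u).numSCC

/-! ### Rooted trees and forests, given by their parent-to-child edges -/

/-- The descendants of `v` in the rooted forest `T` (`v` itself included); `T` is given as the
digraph of its edges, directed from parent to child. -/
def descendants (T : Digraph V) (v : V) : Set V :=
  {w | Relation.ReflTransGen T.Adj v w}

/-- The proper descendants of `v` in the rooted forest `T`. -/
def properDescendants (T : Digraph V) (v : V) : Set V :=
  T.descendants v \ {v}

/-! ### Dominators in the flow graph `G_s` -/

/-- `u` dominates `v` in the flow graph `G_s`: every path from `s` to `v` contains `u`. -/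
def Dominates (G : Digraph V) (s u v : V) : Prop :=
  ∀ p : List V, G.IsPath s v p → u ∈ p

/-- `u` is a proper dominator of `v`. -/
def ProperlyDominates (G : Digraph V) (s u v : V) : Prop :=
  G.Dominates s u v ∧ u ≠ v

/-- `u` is the immediate dominator `d(v)` of `v`: the proper dominator of `v` that is dominated by
all proper dominators of `v`. -/
def IsImmediateDominator (G : Digraph V) (s u v : V) : Prop :=
  G.ProperlyDominates s u v ∧ ∀ w : V, G.ProperlyDominates s w v → G.Dominates s w u

/-- The dominator tree `D` of the flow graph `G_s`: the parent of `v` is its immediate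
dominator. -/
def dominatorTree (G : Digraph V) (s : V) : Digraph V where
  Adj u v := G.IsImmediateDominator s u v

/-- `u` is a nontrivial dominator of the flow graph `G_s`: it dominates some vertex `v`, and
is neither `s` nor `v`. -/
def IsNontrivialDominator (G : Digraph V) (s u : V) : Prop :=
  ∃ v : V, G.Dominates s u v ∧ u ≠ s ∧ u ≠ v

/-! ### Depth-first search -/

/-- A state of a depth-first search: the set of visited vertices, the stack of active vertices
(the current vertex first), and the tree built so far (edges from parent to child). -/
structure DFSState (V : Type*) where
  visited : Set V
  stack : List V
  tree : Digraph V

/-- One step of a depth-first search of `G`: either an edge from the current vertex `v` to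
an unvisited vertex `w` is followed (any such `w` may be chosen), or `v` has no unvisited
out-neighbour and the search backtracks. -/
inductive DFSStep (G : Digraph V) : DFSState V → DFSState V → Prop
  | advance (W : Set V) (v w : V) (st : List V) (T : Digraph V)
      (hadj : G.Adj v w) (hw : w ∉ W) :
      DFSStep G ⟨W, v :: st, T⟩
        ⟨insert w W, w :: v :: st, ⟨fun x y => T.Adj x y ∨ (x = v ∧ y = w)⟩⟩
  | backtrack (W : Set V) (v : V) (st : List V) (T : Digraph V)
      (hdone : ∀ w, G.Adj v w → w ∈ W) :
      DFSStep G ⟨W, v :: st, T⟩ ⟨W, st, T⟩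

/-- `T` is a dfs tree of `G` with start vertex `s`: the tree built by some complete depth-first
search of `G` that starts at `s`. -/
def IsDFSTree (G : Digraph V) (s : V) (T : Digraph V) : Prop :=
  ∃ W : Set V, Relation.ReflTransGen (DFSStep G) ⟨{s}, [s], ⊥⟩ ⟨W, [], T⟩

/-! ### The loop nesting forest with respect to a dfs tree `T` -/

/-- `loop(u)`: the descendants `x` of `u` in `T` such that `G` has a path from `x` to `u` that
contains only descendants of `u` in `T`. -/
def loop (G T : Digraph V) (u : V) : Set V :=
  {x | x ∈ T.descendants u ∧ G.ReachesWithin (T.descendants u) x u}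

/-- The loop nesting forest `H` of `G` with respect to `T`: the parent `h(v)` of `v` is the nearest
proper ancestor `u` of `v` in `T` such that `v ∈ loop(u)`, if there is one. -/
def loopNestingForest (G T : Digraph V) : Digraph V where
  Adj u v := v ∈ T.properDescendants u ∧ v ∈ G.loop T u ∧
    ∀ u' : V, v ∈ T.properDescendants u' → v ∈ G.loop T u' → u ∈ T.descendants u'

end Digraph

/-!
A strongly connected component `C` of `G ∖ u` is a maximal set of mutually reachable vertices
avoiding `u` (`IsSCC.of_deleteVertex`), and `u` fails to dominate `v` exactly when `s` reaches `v`
without meeting `u` (`not_dominates_iff`). Since any two vertices of `C` reach each other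
within `C`, the vertex `u` dominates all of `C` or none of it, in `G_s` as well as in `G_s^R`. If it
dominates none in either graph, then every vertex of `C` is mutually reachable with `s` avoiding
`u`, so `C` is the component of `s`, which consists of all vertices dominated in neither graph. This
gives the four cases once the descendants of `u` in the dominator tree are identified with the
vertices dominated by `u` (`descendants_dominatorTree`).

For the loop nesting trees, the only facts used about a dfs tree `T` are that it is a spanning
tree of `G` rooted at `s`, and that every strongly connected set of vertices contains a `T`-ancestor
of all its members (`IsDFSTree.exists_root`). Let `w` be this vertex for the component `C`, all of
whose vertices are dominated by `u`. Every vertex of `C` reaches `w` within `C`, so `C ⊆ loop(w)`.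
Conversely, `u` is a proper `T`-ancestor of `w`, because it lies on the tree path from `s` to `w`;
so `loop(w)` is a strongly connected set avoiding `u`, and `loop(w) ⊆ C` by maximality. As `H(w)`
always equals `loop(w)` (`descendants_loopNestingForest`), `C = H(w)`. If `h(w)` were properly
dominated by `u`, then by the same argument `loop(h(w))` would avoid `u` and lie in `C`, putting a
proper ancestor of `w` in `C`.
-/

namespace Digraph

variable {V : Type*} {G T : Digraph V} {C S S' : Set V} {a b c s u v w x y z : V}

/-! ### Reachability within a set -/

theorem ReachesWithin.refl (hx : x ∈ S) : G.ReachesWithin S x x :=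
  ⟨[x], ⟨by simp, rfl, rfl⟩, by simpa using hx⟩

theorem ReachesWithin.head (hx : x ∈ S) (hxy : G.Adj x y) (h : G.ReachesWithin S y z) :
    G.ReachesWithin S x z := by
  obtain ⟨p, ⟨hc, hh, hl⟩, hp⟩ := h
  cases p with
  | nil => simp at hh
  | cons q p =>
    obtain rfl : q = y := by simpa using hh
    refine ⟨x :: q :: p, ⟨by simpa using ⟨hxy, by simpa using hc⟩, rfl, by simpa using hl⟩, ?_⟩
    simpa using ⟨hx, by simpa using hp⟩

@[elab_as_elim]
theorem ReachesWithin.head_induction {P : ∀ x, G.ReachesWithin S x y → Prop}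
    (h : G.ReachesWithin S x y) (refl : ∀ hy : y ∈ S, P y (.refl hy))
    (head : ∀ a b (ha : a ∈ S) (hab : G.Adj a b) (hb : G.ReachesWithin S b y), P b hb →
      P a (hb.head ha hab)) : P x h := by
  obtain ⟨p, ⟨hc, hh, hl⟩, hp⟩ := h
  induction p generalizing x with
  | nil => simp at hh
  | cons q p ih =>
    obtain rfl : q = x := by simpa using hh
    cases p with
    | nil =>
      obtain rfl : q = y := by simpa using hl
      exact refl (hp _ (by simp))
    | cons r p =>
      have hc' := List.isChain_cons_cons.1 hc
      have hl' : (r :: p).getLast? = some y := by simpa using hl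
      have hp' : ∀ v ∈ r :: p, v ∈ S := fun v hv => hp v (List.mem_cons_of_mem _ hv)
      exact head q r (hp _ (by simp)) hc'.1 ⟨_, ⟨hc'.2, rfl, hl'⟩, hp'⟩ (ih hp' hc'.2 rfl hl')

theorem ReachesWithin.left_mem (h : G.ReachesWithin S x y) : x ∈ S := by
  obtain ⟨p, ⟨_, hh, _⟩, hp⟩ := h
  exact hp _ (List.mem_of_head? hh)

theorem ReachesWithin.right_mem (h : G.ReachesWithin S x y) : y ∈ S := by
  obtain ⟨p, ⟨_, _, hl⟩, hp⟩ := h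
  exact hp _ (List.mem_of_getLast? hl)

theorem ReachesWithin.trans (h : G.ReachesWithin S x y) (h' : G.ReachesWithin S y z) :
    G.ReachesWithin S x z := by
  induction h using ReachesWithin.head_induction with
  | refl _ => exact h'
  | head a b ha hab _ ih => exact ih.head ha hab

theorem ReachesWithin.mono (hS : S ⊆ S') (h : G.ReachesWithin S x y) :
    G.ReachesWithin S' x y := by
  obtain ⟨p, h, hp⟩ := h
  exact ⟨p, h, fun v hv => hS (hp v hv)⟩

theorem reachesWithin_reverse : G.reverse.ReachesWithin S x y ↔ G.ReachesWithin S y x := by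
  have key : ∀ (G : Digraph V) {x y : V}, G.ReachesWithin S x y →
      G.reverse.ReachesWithin S y x := by
    intro G x y h
    induction h using ReachesWithin.head_induction with
    | refl hy => exact .refl hy
    | head a b ha hab h ih =>
      have hb : b ∈ S := ih.right_mem
      exact ih.trans (.head hb hab (.refl ha))
  exact ⟨fun h => key _ h, fun h => key _ h⟩

theorem StronglyConnected.reachesWithin_univ (hG : G.StronglyConnected) (x y : V) :
    G.ReachesWithin Set.univ x y := by
  obtain ⟨p, hp⟩ := hG x y
  exact ⟨p, hp, fun _ _ => Set.mem_univ _⟩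

theorem StronglyConnected.reverse (hG : G.StronglyConnected) : G.reverse.StronglyConnected := by
  intro x y
  obtain ⟨p, hp, _⟩ := reachesWithin_reverse.2 (hG.reachesWithin_univ y x)
  exact ⟨p, hp⟩

/-! ### Strongly connected sets and components -/

/-- A nonempty set of vertices that induces a strongly connected subgraph. -/
def IsStrongSet (G : Digraph V) (S : Set V) : Prop :=
  S.Nonempty ∧ ∀ x ∈ S, ∀ y ∈ S, G.ReachesWithin S x y

theorem IsStrongSet.reverse (h : G.IsStrongSet S) : G.reverse.IsStrongSet S :=
  ⟨h.1, fun x hx y hy => reachesWithin_reverse.2 (h.2 y hy x hx)⟩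

/-- The vertices lying on a closed walk through `c` within `S`. -/
def mutuallyReachable (G : Digraph V) (S : Set V) (c : V) : Set V :=
  {x | G.ReachesWithin S c x ∧ G.ReachesWithin S x c}

theorem mutuallyReachable_reverse : G.reverse.mutuallyReachable S c = G.mutuallyReachable S c := by
  ext x
  simp only [mutuallyReachable, Set.mem_ofPred_eq, reachesWithin_reverse, and_comm]

theorem reachesWithin_mutuallyReachable (hx : x ∈ G.mutuallyReachable S c) :
    G.ReachesWithin (G.mutuallyReachable S c) x c := by
  obtain ⟨hcx, hxc⟩ := hx
  induction hxc using ReachesWithin.head_induction with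
  | refl hc => exact .refl ⟨.refl hc, .refl hc⟩
  | head a b ha hab hbc ih =>
    exact (ih (hcx.trans (.head ha hab (.refl hbc.left_mem)))).head ⟨hcx, hbc.head ha hab⟩ hab

theorem isStrongSet_mutuallyReachable (hc : c ∈ S) :
    G.IsStrongSet (G.mutuallyReachable S c) := by
  refine ⟨⟨c, .refl hc, .refl hc⟩, fun x hx y hy => ?_⟩
  refine (reachesWithin_mutuallyReachable hx).trans ?_
  rw [← mutuallyReachable_reverse] at hy
  have := reachesWithin_mutuallyReachable hy
  rwa [mutuallyReachable_reverse, reachesWithin_reverse] at this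

theorem IsSCC.isStrongSet (hC : G.IsSCC C) : G.IsStrongSet C := hC.prop

theorem IsStrongSet.subset_mutuallyReachable (hC : G.IsStrongSet C) (hCS : C ⊆ S) (hc : c ∈ C) :
    C ⊆ G.mutuallyReachable S c :=
  fun x hx => ⟨(hC.2 c hc x hx).mono hCS, (hC.2 x hx c hc).mono hCS⟩

theorem IsSCC.eq_mutuallyReachable (hC : G.IsSCC C) (hc : c ∈ C) :
    C = G.mutuallyReachable Set.univ c :=
  have h := hC.isStrongSet.subset_mutuallyReachable (Set.subset_univ C) hc
  h.antisymm (hC.le_of_ge (isStrongSet_mutuallyReachable (Set.mem_univ c)) h)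

theorem StronglyConnected.isSCC_iff [Nonempty V] (hG : G.StronglyConnected) :
    G.IsSCC C ↔ C = Set.univ := by
  constructor
  · intro hC
    obtain ⟨c, hc⟩ := hC.isStrongSet.1
    rw [hC.eq_mutuallyReachable hc]
    exact Set.eq_univ_of_forall fun x => ⟨hG.reachesWithin_univ _ _, hG.reachesWithin_univ _ _⟩
  · rintro rfl
    exact ⟨⟨Set.univ_nonempty, fun x _ y _ => hG.reachesWithin_univ x y⟩,
      fun _ _ _ => Set.subset_univ _⟩

theorem StronglyConnected.numSCC_eq_one [Nonempty V] (hG : G.StronglyConnected) :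
    G.numSCC = 1 := by
  simp [numSCC, hG.isSCC_iff]

theorem reachesWithin_deleteVertex {S : Set {v : V // v ≠ u}} {x y : {v : V // v ≠ u}} :
    (G.deleteVertex u).ReachesWithin S x y ↔ G.ReachesWithin (Subtype.val '' S) x.1 y.1 := by
  constructor
  · intro h
    induction h using ReachesWithin.head_induction with
    | refl hy => exact .refl ⟨_, hy, rfl⟩
    | head a b ha hab _ ih => exact ih.head ⟨_, ha, rfl⟩ hab
  · intro h
    have key : ∀ a : V, G.ReachesWithin (Subtype.val '' S) a y.1 →
        ∀ ha : a ≠ u, (G.deleteVertex u).ReachesWithin S ⟨a, ha⟩ y := by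
      intro a h
      induction h using ReachesWithin.head_induction with
      | refl hy => exact fun _ => .refl (Subtype.val_injective.mem_set_image.1 hy)
      | head a b ha hab hb ih =>
        intro hau
        obtain ⟨b', -, hb'⟩ := hb.left_mem
        have hbu : b ≠ u := hb' ▸ b'.2
        have hab' : (G.deleteVertex u).Adj ⟨a, hau⟩ ⟨b, hbu⟩ := hab
        exact (ih hbu).head (by simpa [hau] using ha) hab'
    exact key _ h x.2

theorem IsSCC.isStrongSet_image {C' : Set {v : V // v ≠ u}} (hC : (G.deleteVertex u).IsSCC C') :
    G.IsStrongSet (Subtype.val '' C') := by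
  refine ⟨hC.isStrongSet.1.image _, ?_⟩
  rintro _ ⟨x, hx, rfl⟩ _ ⟨y, hy, rfl⟩
  exact reachesWithin_deleteVertex.1 (hC.isStrongSet.2 x hx y hy)

theorem IsSCC.image_eq_mutuallyReachable {C' : Set {v : V // v ≠ u}}
    (hC : (G.deleteVertex u).IsSCC C') (hc : c ∈ Subtype.val '' C') :
    Subtype.val '' C' = G.mutuallyReachable {u}ᶜ c := by
  obtain ⟨c, hc, rfl⟩ := hc
  have hu : Subtype.val '' (Set.univ : Set {v : V // v ≠ u}) = {u}ᶜ := by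
    ext x; simp
  rw [hC.eq_mutuallyReachable hc]
  ext x
  constructor
  · rintro ⟨x, hx, rfl⟩
    have h1 := reachesWithin_deleteVertex.1 hx.1
    have h2 := reachesWithin_deleteVertex.1 hx.2
    rw [hu] at h1 h2
    exact ⟨h1, h2⟩
  · intro hx
    refine ⟨⟨x, hx.2.left_mem⟩, ⟨reachesWithin_deleteVertex.2 ?_, reachesWithin_deleteVertex.2 ?_⟩,
      rfl⟩
    · rw [hu]; exact hx.1
    · rw [hu]; exact hx.2

/-! ### Dominators and the dominator tree -/

theorem not_dominates_iff : ¬ G.Dominates s u v ↔ G.ReachesWithin {u}ᶜ s v := by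
  simp only [Dominates, ReachesWithin, not_forall, exists_prop]
  refine exists_congr fun p => and_congr_right fun _ => ?_
  exact ⟨fun h v hv hvu => h (hvu ▸ hv), fun h hu => h u hu rfl⟩

theorem not_dominates_reverse_iff :
    ¬ G.reverse.Dominates s u v ↔ G.ReachesWithin {u}ᶜ v s := by
  rw [not_dominates_iff, reachesWithin_reverse]

theorem dominates_refl : G.Dominates s v v :=
  fun _ hp => List.mem_of_getLast? hp.2.2

theorem eq_of_dominates_start (h : G.Dominates s u s) : u = s := by
  simpa using h [s] ⟨by simp, rfl, rfl⟩

theorem dominates_start : G.Dominates s s v :=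
  fun _ hp => List.mem_of_head? hp.2.1

theorem Dominates.trans (huv : G.Dominates s u v) (hvw : G.Dominates s v w) :
    G.Dominates s u w := by
  by_contra h
  -- A path from `s` to `w` that avoids `u` meets `v`; it cannot, as `u` dominates `v`.
  have key : ∀ x, G.ReachesWithin {u}ᶜ x w → G.ReachesWithin {u}ᶜ s x →
      G.ReachesWithin {v}ᶜ x w := by
    intro x hx
    induction hx using ReachesWithin.head_induction with
    | refl hw =>
      intro hsx
      refine .refl ?_
      rintro rfl
      exact not_dominates_iff.2 hsx huv
    | head a b ha hab hb ih =>
      intro hsa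
      refine (ih (hsa.trans (.head ha hab (.refl hb.left_mem)))).head ?_ hab
      rintro rfl
      exact not_dominates_iff.2 hsa huv
  have h := not_dominates_iff.1 h
  exact not_dominates_iff.2 (key s h (.refl h.left_mem)) hvw

/-- A walk from `x` to `v` avoids both `a` and `b`, or else its part after the last visit to one of
them avoids the other. -/
theorem ReachesWithin.last_visit (hab : a ≠ b) (h : G.ReachesWithin S x v) :
    G.ReachesWithin {a, b}ᶜ x v ∨ G.ReachesWithin {b}ᶜ a v ∨ G.ReachesWithin {a}ᶜ b v := by
  induction h using ReachesWithin.head_induction with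
  | refl _ =>
    by_cases hva : v = a
    · subst hva; exact .inr (.inl (.refl hab))
    by_cases hvb : v = b
    · subst hvb; exact .inr (.inr (.refl hab.symm))
    exact .inl (.refl (by simp [hva, hvb]))
  | head x y _ hxy _ ih =>
    rcases ih with ih | ih
    · by_cases hxa : x = a
      · subst hxa; exact .inr (.inl ((ih.mono (by simp)).head hab hxy))
      by_cases hxb : x = b
      · subst hxb; exact .inr (.inr ((ih.mono (by simp)).head hab.symm hxy))
      exact .inl (ih.head (by simp [hxa, hxb]) hxy)
    · exact .inr ih

/-- The dominators of a vertex are linearly ordered by dominance. -/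
theorem Dominates.total (hG : G.StronglyConnected) (ha : G.Dominates s a v)
    (hb : G.Dominates s b v) : G.Dominates s a b ∨ G.Dominates s b a := by
  by_cases hab : a = b
  · exact .inl (hab ▸ dominates_refl)
  by_contra! h
  have hsb := not_dominates_iff.1 h.1
  have hsa := not_dominates_iff.1 h.2
  rcases (hG.reachesWithin_univ s v).last_visit hab with h | h | h
  · exact not_dominates_iff.2 (h.mono (by simp)) ha
  · exact not_dominates_iff.2 (hsa.trans h) hb
  · exact not_dominates_iff.2 (hsb.trans h) ha

theorem Dominates.antisymm (hG : G.StronglyConnected) (hab : G.Dominates s a b)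
    (hba : G.Dominates s b a) : a = b := by
  by_contra hne
  -- The first visit to `a` or `b` of a walk from `s` is the last visit of the reversed walk.
  rcases (hG.reverse.reachesWithin_univ b s).last_visit hne with h | h | h
  · exact h.left_mem (by simp)
  · exact not_dominates_iff.2 (reachesWithin_reverse.1 h) hba
  · exact not_dominates_iff.2 (reachesWithin_reverse.1 h) hab

theorem ProperlyDominates.dominators_ssubset (hG : G.StronglyConnected)
    (h : G.ProperlyDominates s u v) :
    {w | G.Dominates s w u} ⊂ {w | G.Dominates s w v} :=
  ⟨fun _ hw => Dominates.trans hw h.1,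
    fun hsub => h.2 (h.1.antisymm hG (hsub (dominates_refl : G.Dominates s v v)))⟩

theorem ProperlyDominates.exists_isImmediateDominator [Finite V] (hG : G.StronglyConnected)
    (h : G.ProperlyDominates s u v) : ∃ d, G.IsImmediateDominator s d v := by
  -- The immediate dominator is the proper dominator that has the most dominators itself.
  obtain ⟨d, hd, hmax⟩ := Set.exists_max_image {w | G.ProperlyDominates s w v}
    (fun w => {x | G.Dominates s x w}.ncard) (Set.toFinite _) ⟨u, h⟩
  refine ⟨d, hd, fun w hw => ?_⟩
  by_contra hwd
  have hdw : G.ProperlyDominates s d w :=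
    ⟨(hw.1.total hG hd.1).resolve_left hwd, fun e => hwd (e ▸ dominates_refl)⟩
  exact (Set.ncard_lt_ncard (hdw.dominators_ssubset hG)).not_ge (hmax w hw)

theorem descendants_dominatorTree [Finite V] (hG : G.StronglyConnected) :
    (G.dominatorTree s).descendants u = {v | G.Dominates s u v} := by
  ext v
  constructor
  · intro h
    induction h with
    | refl => exact dominates_refl
    | tail _ hvw ih => exact Dominates.trans ih hvw.1.1
  · intro h
    induction hn : {w | G.Dominates s w v}.ncard using Nat.strong_induction_on generalizing v with
    | _ n ih =>
      subst hn
      by_cases huv : u = v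
      · subst huv; exact .refl
      · obtain ⟨d, hd⟩ := ProperlyDominates.exists_isImmediateDominator hG ⟨h, huv⟩
        exact (ih _ (Set.ncard_lt_ncard (hd.1.dominators_ssubset hG)) d
          (hd.2 u ⟨h, huv⟩) rfl).tail hd

theorem mem_properDescendants_dominatorTree [Finite V] (hG : G.StronglyConnected) :
    v ∈ (G.dominatorTree s).properDescendants u ↔ G.Dominates s u v ∧ v ≠ u := by
  simp [properDescendants, descendants_dominatorTree hG]

/-! ### Depth-first search trees -/

theorem mem_descendants_of_mem_stack {l : List V}
    (hl : (a :: l).IsChain fun x y => T.Adj y x) (hx : x ∈ a :: l) : a ∈ T.descendants x := by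
  induction l generalizing a with
  | nil =>
    obtain rfl : x = a := by simpa using hx
    exact .refl
  | cons b l ih =>
    rcases List.mem_cons.1 hx with rfl | hx
    · exact .refl
    · have h := List.isChain_cons_cons.1 hl
      exact Relation.ReflTransGen.tail (ih h.2 hx) h.1

theorem descendants_subset (h : x ∈ T.descendants w) : T.descendants x ⊆ T.descendants w :=
  fun _ hy => Relation.ReflTransGen.trans h hy

theorem eq_or_rank_lt {f : V → ℕ} (hf : ∀ x y, T.Adj x y → f x < f y)
    (h : y ∈ T.descendants x) : x = y ∨ f x < f y := by
  induction h with
  | refl => exact .inl rfl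
  | tail _ hyz ih =>
    rcases ih with rfl | ih
    · exact .inr (hf _ _ hyz)
    · exact .inr (ih.trans (hf _ _ hyz))

theorem descendants_antisymm {f : V → ℕ} (hf : ∀ x y, T.Adj x y → f x < f y)
    (hxy : y ∈ T.descendants x) (hyx : x ∈ T.descendants y) : x = y := by
  rcases eq_or_rank_lt hf hxy with h | h
  · exact h
  rcases eq_or_rank_lt hf hyx with h' | h'
  · exact h'.symm
  · omega

/-- The facts about a state of a depth-first search that hold at all times. -/
structure DFSInvariant (G : Digraph V) (s : V) (σ : DFSState V) : Prop where
  start_mem : s ∈ σ.visited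
  stack_subset : ∀ x ∈ σ.stack, x ∈ σ.visited
  /-- The stack is a path of the tree, read from the current vertex upwards. -/
  stack_chain : σ.stack.IsChain fun x y => σ.tree.Adj y x
  adj_of_tree : ∀ x y, σ.tree.Adj x y → G.Adj x y ∧ x ∈ σ.visited ∧ y ∈ σ.visited
  parent_unique : ∀ x y z, σ.tree.Adj x z → σ.tree.Adj y z → x = y
  /-- The tree is acyclic; the depth of a vertex is such a rank. -/
  exists_rank : ∃ f : V → ℕ, ∀ x y, σ.tree.Adj x y → f x < f y
  visited_subset : ∀ x ∈ σ.visited, x ∈ σ.tree.descendants s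
  /-- The out-neighbours of a vertex that has left the stack are visited. -/
  finished : ∀ x ∈ σ.visited, x ∉ σ.stack → ∀ y, G.Adj x y → y ∈ σ.visited
  /-- The first visited vertex `w` of a strongly connected set `S` is an ancestor of all visited
  vertices of `S`, and does not leave the stack before all of `S` is visited. -/
  strongSet_root : ∀ S, G.IsStrongSet S → Disjoint σ.visited S ∨
    ∃ w ∈ S, σ.visited ∩ S ⊆ σ.tree.descendants w ∧ (w ∈ σ.stack ∨ S ⊆ σ.visited)

theorem DFSInvariant.init : DFSInvariant G s ⟨{s}, [s], ⊥⟩ where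
  start_mem := rfl
  stack_subset := by simp
  stack_chain := by simp
  adj_of_tree _ _ h := h.elim
  parent_unique _ _ _ h := h.elim
  exists_rank := ⟨fun _ => 0, fun _ _ h => h.elim⟩
  visited_subset := by rintro _ rfl; exact .refl
  finished := by rintro x rfl h; simp at h
  strongSet_root S _ := by
    by_cases hs : s ∈ S
    · refine .inr ⟨s, hs, ?_, .inl (by simp)⟩
      rintro _ ⟨rfl, _⟩
      exact .refl
    · exact .inl (by simpa using hs)

theorem ReachesWithin.mem_of_closed {W : Set V} (h : G.ReachesWithin S x y) (hx : x ∈ W)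
    (hW : ∀ a ∈ W, a ∈ S → ∀ b, G.Adj a b → b ∈ W) : y ∈ W := by
  induction h using ReachesWithin.head_induction with
  | refl _ => exact hx
  | head a b ha hab _ ih => exact ih (hW a hx ha b hab)

theorem DFSInvariant.advance {W : Set V} {st : List V} (h : DFSInvariant G s ⟨W, v :: st, T⟩)
    (hadj : G.Adj v w) (hw : w ∉ W) :
    DFSInvariant G s
      ⟨insert w W, w :: v :: st, ⟨fun x y => T.Adj x y ∨ (x = v ∧ y = w)⟩⟩ := by
  set T' : Digraph V := ⟨fun x y => T.Adj x y ∨ (x = v ∧ y = w)⟩ with hT'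
  have hv : v ∈ W := h.stack_subset v (by simp)
  have hmono : ∀ x, T.descendants x ⊆ T'.descendants x :=
    fun x y hy => by
      replace hy : Relation.ReflTransGen T.Adj x y := hy
      change Relation.ReflTransGen T'.Adj x y
      induction hy with
      | refl => exact .refl
      | tail _ hab ih => exact ih.tail (.inl hab)
  have hvw : T'.Adj v w := .inr ⟨rfl, rfl⟩
  constructor
  · exact .inr h.start_mem
  · intro x hx
    rcases List.mem_cons.1 hx with rfl | hx
    · exact .inl rfl
    · exact .inr (h.stack_subset x hx)
  · exact List.isChain_cons_cons.2 ⟨hvw, h.stack_chain.imp fun _ _ hab => Or.inl hab⟩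
  · rintro x y (hxy | ⟨rfl, rfl⟩)
    · obtain ⟨h1, h2, h3⟩ := h.adj_of_tree x y hxy
      exact ⟨h1, .inr h2, .inr h3⟩
    · exact ⟨hadj, .inr hv, .inl rfl⟩
  · rintro x y z (hxz | ⟨rfl, rfl⟩) (hyz | ⟨rfl, hz⟩)
    · exact h.parent_unique x y z hxz hyz
    · exact absurd (hz ▸ (h.adj_of_tree _ _ hxz).2.2) hw
    · exact absurd (h.adj_of_tree _ _ hyz).2.2 hw
    · rfl
  · classical
    obtain ⟨f, hf⟩ := h.exists_rank
    refine ⟨Function.update f w (f v + 1), ?_⟩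
    have hne : ∀ x ∈ W, x ≠ w := fun x hx e => hw (e ▸ hx)
    rintro x y (hxy | ⟨rfl, rfl⟩)
    · obtain ⟨-, h2, h3⟩ := h.adj_of_tree x y hxy
      simpa [hne x h2, hne y h3] using hf x y hxy
    · simp [hne x hv]
  · rintro x (rfl | hx)
    · exact Relation.ReflTransGen.tail (hmono _ (h.visited_subset v hv)) hvw
    · exact hmono _ (h.visited_subset x hx)
  · rintro x (rfl | hx) hxst y hxy
    · simp at hxst
    · exact .inr (h.finished x hx (fun hx' => hxst (List.mem_cons_of_mem _ hx')) y hxy)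
  · intro S hS
    rcases h.strongSet_root S hS with hd | ⟨r, hr, hsub, hstack⟩
    · by_cases hwS : w ∈ S
      · refine .inr ⟨w, hwS, ?_, .inl (by simp)⟩
        rintro x ⟨rfl | hx, hxS⟩
        · exact .refl
        · exact (Set.disjoint_left.1 hd hx hxS).elim
      · refine .inl (Set.disjoint_left.2 ?_)
        rintro x (rfl | hx) hxS
        · exact hwS hxS
        · exact Set.disjoint_left.1 hd hx hxS
    · refine .inr ⟨r, hr, ?_, hstack.imp (List.mem_cons_of_mem _)
        fun h => h.trans (Set.subset_insert _ _)⟩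
      rintro x ⟨rfl | hx, hxS⟩
      · have hrst := hstack.resolve_right fun h => hw (h hxS)
        exact Relation.ReflTransGen.tail
          (hmono _ (mem_descendants_of_mem_stack h.stack_chain hrst)) hvw
      · exact hmono _ (hsub ⟨hx, hxS⟩)

theorem DFSInvariant.backtrack {W : Set V} {st : List V} (h : DFSInvariant G s ⟨W, v :: st, T⟩)
    (hdone : ∀ w, G.Adj v w → w ∈ W) : DFSInvariant G s ⟨W, st, T⟩ where
  start_mem := h.start_mem
  stack_subset x hx := h.stack_subset x (List.mem_cons_of_mem _ hx)
  stack_chain := List.IsChain.tail h.stack_chain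
  adj_of_tree := h.adj_of_tree
  parent_unique := h.parent_unique
  exists_rank := h.exists_rank
  visited_subset := h.visited_subset
  finished x hx hxst := by
    by_cases hxv : x = v
    · exact hxv ▸ hdone
    · exact h.finished x hx (by simpa [hxv] using hxst)
  strongSet_root S hS := by
    refine (h.strongSet_root S hS).imp_right ?_
    rintro ⟨r, hr, hsub, hstack⟩
    refine ⟨r, hr, hsub, ?_⟩
    rcases hstack with hstack | hstack
    · rcases List.mem_cons.1 hstack with rfl | hstack
      · -- All stack vertices are ancestors of `r`, so no other one of them lies in `S`. Thus
        -- the visited part of `S` is closed under edges inside `S`.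
        refine .inr fun y hy => (hS.2 r hr y hy).mem_of_closed (h.stack_subset r (by simp)) ?_
        intro a ha haS b hab
        by_cases hast : a ∈ r :: st
        · obtain ⟨f, hf⟩ := h.exists_rank
          have := descendants_antisymm hf (hsub ⟨ha, haS⟩)
            (mem_descendants_of_mem_stack h.stack_chain hast)
          exact hdone b (this ▸ hab)
        · exact h.finished a ha hast b hab
      · exact .inl hstack
    · exact .inr hstack

theorem IsDFSTree.exists_invariant (hT : G.IsDFSTree s T) :
    ∃ W : Set V, DFSInvariant G s ⟨W, [], T⟩ := by
  obtain ⟨W, hW⟩ := hT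
  refine ⟨W, ?_⟩
  generalize (⟨W, [], T⟩ : DFSState V) = σ at hW
  induction hW with
  | refl => exact .init
  | tail _ hstep ih =>
    cases hstep with
    | advance W v w st T hadj hw => exact ih.advance hadj hw
    | backtrack W v st T hdone => exact ih.backtrack hdone

theorem IsDFSTree.adj (hT : G.IsDFSTree s T) (h : T.Adj x y) : G.Adj x y := by
  obtain ⟨W, hW⟩ := hT.exists_invariant
  exact (hW.adj_of_tree x y h).1

theorem IsDFSTree.exists_rank (hT : G.IsDFSTree s T) :
    ∃ f : V → ℕ, ∀ x y, T.Adj x y → f x < f y := by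
  obtain ⟨W, hW⟩ := hT.exists_invariant
  exact hW.exists_rank

theorem IsDFSTree.ancestors_total (hT : G.IsDFSTree s T) (hx : z ∈ T.descendants x)
    (hy : z ∈ T.descendants y) : x ∈ T.descendants y ∨ y ∈ T.descendants x := by
  obtain ⟨W, hW⟩ := hT.exists_invariant
  induction hx with
  | refl => exact .inl hy
  | tail hxb hbc ih =>
    rcases Relation.ReflTransGen.cases_tail hy with rfl | ⟨d, hyd, hd⟩
    · exact .inr (hxb.tail hbc)
    · exact ih (hW.parent_unique _ _ _ hd hbc ▸ hyd)

theorem DFSInvariant.visited_eq_univ (hG : G.StronglyConnected) {W : Set V}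
    (hW : DFSInvariant G s ⟨W, [], T⟩) (x : V) : x ∈ W :=
  (hG.reachesWithin_univ s x).mem_of_closed hW.start_mem
    fun a ha _ b hab => hW.finished a ha (by simp) b hab

theorem IsDFSTree.mem_descendants_start (hG : G.StronglyConnected) (hT : G.IsDFSTree s T) (x : V) :
    x ∈ T.descendants s := by
  obtain ⟨W, hW⟩ := hT.exists_invariant
  exact hW.visited_subset x (hW.visited_eq_univ hG x)

/-- Every strongly connected set of vertices contains an ancestor of all its members. -/
theorem IsDFSTree.exists_root (hG : G.StronglyConnected) (hT : G.IsDFSTree s T)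
    (hS : G.IsStrongSet S) : ∃ w ∈ S, S ⊆ T.descendants w := by
  obtain ⟨W, hW⟩ := hT.exists_invariant
  have hmem := hW.visited_eq_univ hG
  rcases hW.strongSet_root S hS with h | ⟨w, hw, hsub, -⟩
  · obtain ⟨x, hx⟩ := hS.1
    exact (Set.disjoint_left.1 h (hmem x) hx).elim
  · exact ⟨w, hw, fun x hx => hsub ⟨hmem x, hx⟩⟩

theorem IsDFSTree.mem_descendants_of_dominates (hG : G.StronglyConnected) (hT : G.IsDFSTree s T)
    (h : G.Dominates s u v) : v ∈ T.descendants u := by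
  have key : v ∈ T.descendants u ∨ G.ReachesWithin {u}ᶜ s v := by
    clear h
    have hv : Relation.ReflTransGen T.Adj s v := hT.mem_descendants_start hG v
    induction hv with
    | refl =>
      by_cases hsu : s = u
      · subst hsu; exact .inl .refl
      · exact .inr (.refl hsu)
    | @tail y z _ hyz ih =>
      rcases ih with ih | ih
      · exact .inl (Relation.ReflTransGen.tail ih hyz)
      · by_cases hzu : z = u
        · subst hzu; exact .inl .refl
        · exact .inr (ih.trans (.head ih.right_mem (hT.adj hyz) (.refl hzu)))
  exact key.resolve_right fun h' => not_dominates_iff.2 h' h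

/-- If `u` properly dominates `v`, it is a proper ancestor of `v` in every dfs tree. -/
theorem IsDFSTree.notMem_descendants_of_dominates (hG : G.StronglyConnected)
    (hT : G.IsDFSTree s T) (h : G.Dominates s u v) (hvu : v ≠ u) : u ∉ T.descendants v := by
  obtain ⟨f, hf⟩ := hT.exists_rank
  exact fun hu => hvu (descendants_antisymm hf hu (hT.mem_descendants_of_dominates hG h))

/-! ### The loop nesting tree -/

theorem IsDFSTree.reachesWithin_descendants (hT : G.IsDFSTree s T) (h : x ∈ T.descendants w) :
    G.ReachesWithin (T.descendants w) w x := by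
  induction h with
  | refl => exact .refl .refl
  | tail hwy hyz ih => exact ih.trans (.head hwy (hT.adj hyz) (.refl (hwy.tail hyz)))

theorem IsDFSTree.loop_eq_mutuallyReachable (hT : G.IsDFSTree s T) :
    G.loop T w = G.mutuallyReachable (T.descendants w) w := by
  ext x
  exact and_congr_left fun _ => ⟨hT.reachesWithin_descendants, fun h => h.right_mem⟩

theorem IsDFSTree.isStrongSet_loop (hT : G.IsDFSTree s T) : G.IsStrongSet (G.loop T w) := by
  rw [hT.loop_eq_mutuallyReachable]
  exact isStrongSet_mutuallyReachable .refl

theorem loop_subset (h : x ∈ G.loop T w) : G.loop T x ⊆ G.loop T w :=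
  fun _ hy => ⟨descendants_subset h.1 hy.1, (hy.2.mono (descendants_subset h.1)).trans h.2⟩

theorem IsDFSTree.exists_loopNestingForest_adj [Finite V] (hT : G.IsDFSTree s T)
    (hv : v ∈ G.loop T u) (hvu : v ≠ u) : ∃ h, (G.loopNestingForest T).Adj h v := by
  obtain ⟨f, hf⟩ := hT.exists_rank
  obtain ⟨p, hp, hmax⟩ := Set.exists_max_image {p | v ∈ G.loop T p ∧ v ≠ p} f (Set.toFinite _)
    ⟨u, hv, hvu⟩
  refine ⟨p, ⟨hp.1.1, hp.2⟩, hp.1, fun q hvq hq => ?_⟩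
  rcases hT.ancestors_total hp.1.1 hq.1 with h | h
  · exact h
  · rcases eq_or_rank_lt hf h with rfl | hlt
    · exact .refl
    · exact ((hmax q ⟨hq, hvq.2⟩).not_gt hlt).elim

theorem IsDFSTree.descendants_loopNestingForest [Finite V] (hT : G.IsDFSTree s T) :
    (G.loopNestingForest T).descendants w = G.loop T w := by
  ext x
  constructor
  · intro h
    induction h with
    | refl => exact ⟨.refl, .refl .refl⟩
    | tail _ hyz ih => exact loop_subset ih hyz.2.1
  · intro hx
    obtain ⟨f, hf⟩ := hT.exists_rank
    induction hn : f x using Nat.strong_induction_on generalizing x with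
    | _ n ih =>
      subst hn
      by_cases hxw : x = w
      · subst hxw; exact .refl
      obtain ⟨p, hp⟩ := hT.exists_loopNestingForest_adj hx hxw
      have hpw : p ∈ T.descendants w := hp.2.2 w ⟨hx.1, hxw⟩ hx
      have hlt : f p < f x := (eq_or_rank_lt hf hp.1.1).resolve_left (Ne.symm hp.1.2)
      -- `p` descends to `x` in the tree, and `x` returns to `w`.
      have hploop : p ∈ G.loop T w :=
        ⟨hpw, ((hT.reachesWithin_descendants hp.1.1).mono (descendants_subset hpw)).trans hx.2⟩
      exact (ih _ hlt p hploop rfl).tail hp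

/-- A maximal strongly connected set `C` avoiding `u`, all of whose vertices are dominated by `u`,
is a subtree of the loop nesting tree, and the parent of its root is not properly dominated
by `u`. -/
theorem IsDFSTree.exists_eq_descendants_loopNestingForest [Finite V] (hG : G.StronglyConnected)
    (hT : G.IsDFSTree s T) (hC : G.IsStrongSet C)
    (hmax : ∀ S, G.IsStrongSet S → u ∉ S → (S ∩ C).Nonempty → S ⊆ C)
    (hCu : C ⊆ (G.dominatorTree s).properDescendants u) :
    ∃ w ∈ (G.dominatorTree s).properDescendants u,
      (∃ h, (G.loopNestingForest T).Adj h w ∧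
        h ∉ (G.dominatorTree s).properDescendants u) ∧
      C = (G.loopNestingForest T).descendants w := by
  obtain ⟨f, hf⟩ := hT.exists_rank
  obtain ⟨w, hw, hroot⟩ := hT.exists_root hG hC
  have hloop : ∀ v ∈ (G.dominatorTree s).properDescendants u, (G.loop T v ∩ C).Nonempty →
      G.loop T v ⊆ C := by
    intro v hv
    rw [mem_properDescendants_dominatorTree hG] at hv
    exact hmax _ hT.isStrongSet_loop
      fun hu => hT.notMem_descendants_of_dominates hG hv.1 hv.2 hu.1
  have hself : ∀ v, v ∈ G.loop T v := fun v => ⟨.refl, .refl .refl⟩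
  refine ⟨w, hCu hw, ?_, ?_⟩
  · have hws : w ≠ s := by
      rintro rfl
      have h := (mem_properDescendants_dominatorTree hG).1 (hCu hw)
      exact h.2 (eq_of_dominates_start h.1).symm
    have hwloop : w ∈ G.loop T s := ⟨hT.mem_descendants_start hG w,
      (hG.reachesWithin_univ w s).mono fun x _ => hT.mem_descendants_start hG x⟩
    obtain ⟨p, hp⟩ := hT.exists_loopNestingForest_adj hwloop hws
    refine ⟨p, hp, fun hpu => hp.1.2 ?_⟩
    have hpC : p ∈ C := hloop p hpu ⟨w, hp.2.1, hw⟩ (hself p)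
    exact descendants_antisymm hf (hroot hpC) hp.1.1
  · rw [hT.descendants_loopNestingForest]
    exact Set.Subset.antisymm (fun x hx => ⟨hroot hx, (hC.2 x hx w hw).mono hroot⟩)
      (hloop w (hCu hw) ⟨w, hself w, hw⟩)

/-! ### Components of the graph without `u` -/

/-- Dominance by `u` is constant on strongly connected sets avoiding `u`. -/
theorem IsStrongSet.dominates_of_dominates (hC : G.IsStrongSet C) (hu : u ∉ C) (hx : x ∈ C)
    (hy : y ∈ C) (h : G.Dominates s u x) : G.Dominates s u y := by
  by_contra hn
  refine not_dominates_iff.2 ((not_dominates_iff.1 hn).trans ((hC.2 y hy x hx).mono ?_)) h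
  exact fun z hz hzu => hu (hzu ▸ hz)

theorem eq_of_dominates_of_not_isNontrivialDominator (h : ¬ G.IsNontrivialDominator s u)
    (hus : u ≠ s) (huv : G.Dominates s u v) : u = v := by
  by_contra hne
  exact h ⟨v, huv, hus, hne⟩

/-- A strong articulation point other than `s` separates some vertex from `s`, in one of the two
directions. -/
theorem IsStrongArticulationPoint.isNontrivialDominator (hG : G.StronglyConnected)
    (hu : G.IsStrongArticulationPoint u) (hus : u ≠ s) :
    G.IsNontrivialDominator s u ∨ G.reverse.IsNontrivialDominator s u := by
  by_contra! h
  have : Nonempty V := ⟨u⟩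
  have : Nonempty {v : V // v ≠ u} := ⟨⟨s, hus.symm⟩⟩
  have hdel : (G.deleteVertex u).StronglyConnected := by
    intro x y
    have hxs : G.ReachesWithin {u}ᶜ x s := not_dominates_reverse_iff.1 fun hx =>
      x.2 (eq_of_dominates_of_not_isNontrivialDominator h.2 hus hx).symm
    have hsy : G.ReachesWithin {u}ᶜ s y := not_dominates_iff.1 fun hy =>
      y.2 (eq_of_dominates_of_not_isNontrivialDominator h.1 hus hy).symm
    have himage : Subtype.val '' (Set.univ : Set {v : V // v ≠ u}) = {u}ᶜ := by
      ext x; simp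
    obtain ⟨p, hp, -⟩ := reachesWithin_deleteVertex.2 (himage.symm ▸ hxs.trans hsy)
    exact ⟨p, hp⟩
  have hlt : G.numSCC < (G.deleteVertex u).numSCC := hu
  rw [hG.numSCC_eq_one, hdel.numSCC_eq_one] at hlt
  exact lt_irrefl _ hlt

end Digraph

open Digraph

theorem mainTheorem8 {V : Type*} [Finite V] (G : Digraph V) (hG : G.StronglyConnected)
    (s u : V) (hu : G.IsStrongArticulationPoint u)
    (T TR : Digraph V) (hT : G.IsDFSTree s T) (hTR : G.reverse.IsDFSTree s TR)
    (D DR H HR : Digraph V)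
    (hD : D = G.dominatorTree s) (hDR : DR = G.reverse.dominatorTree s)
    (hH : H = G.loopNestingForest T) (hHR : HR = G.reverse.loopNestingForest TR)
    (C' : Set {v : V // v ≠ u}) (hC' : (G.deleteVertex u).IsSCC C')
    (C : Set V) (hC : C = Subtype.val '' C') :
    -- the four cases are exhaustive
    ((G.IsNontrivialDominator s u ∧ ¬ G.reverse.IsNontrivialDominator s u) ∨
      (G.reverse.IsNontrivialDominator s u ∧ ¬ G.IsNontrivialDominator s u) ∨
      (G.IsNontrivialDominator s u ∧ G.reverse.IsNontrivialDominator s u) ∨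
      u = s) ∧
    -- (a)
    (G.IsNontrivialDominator s u → ¬ G.reverse.IsNontrivialDominator s u →
      C ⊆ D.properDescendants u ∨ C = (D.descendants u)ᶜ) ∧
    -- (b)
    (G.reverse.IsNontrivialDominator s u → ¬ G.IsNontrivialDominator s u →
      C ⊆ DR.properDescendants u ∨ C = (DR.descendants u)ᶜ) ∧
    -- (c)
    (G.IsNontrivialDominator s u → G.reverse.IsNontrivialDominator s u →
      C ⊆ D.properDescendants u \ DR.properDescendants u ∨
      C ⊆ DR.properDescendants u \ D.properDescendants u ∨
      C ⊆ D.properDescendants u ∩ DR.properDescendants u ∨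
      C = (D.descendants u ∪ DR.descendants u)ᶜ) ∧
    -- (d)
    (u = s → C ⊆ D.properDescendants u) ∧
    -- components inside the proper descendants of `u` are loop nesting subtrees
    (C ⊆ D.properDescendants u →
      ∃ w ∈ D.properDescendants u,
        (∃ h, H.Adj h w ∧ h ∉ D.properDescendants u) ∧ C = H.descendants w) ∧
    (C ⊆ DR.properDescendants u →
      ∃ w ∈ DR.properDescendants u,
        (∃ h, HR.Adj h w ∧ h ∉ DR.properDescendants u) ∧ C = HR.descendants w) := by 
  subst hD hDR hH hHR hC
  set C := Subtype.val '' C' with hCdef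
  have hGR := hG.reverse
  have hC : G.IsStrongSet C := hC'.isStrongSet_image
  have hCR : G.reverse.IsStrongSet C := hC.reverse
  have huC : u ∉ C := by
    rintro ⟨x, -, hx⟩
    exact x.2 hx
  have hmax : ∀ S, G.IsStrongSet S → u ∉ S → (S ∩ C).Nonempty → S ⊆ C := by
    rintro S hS huS ⟨c, hcS, hcC⟩
    rw [hCdef, hC'.image_eq_mutuallyReachable hcC]
    exact hS.subset_mutuallyReachable (fun x hx hxu => huS (hxu ▸ hx)) hcS
  have hmaxR : ∀ S, G.reverse.IsStrongSet S → u ∉ S → (S ∩ C).Nonempty → S ⊆ C :=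
    fun S hS => hmax S hS.reverse
  obtain ⟨c, hc⟩ := hC.1
  have hne : ∀ {x}, x ∈ C → x ≠ u := fun hx e => huC (e ▸ hx)
  simp only [descendants_dominatorTree hG, descendants_dominatorTree hGR]
  have hsub : C ⊆ (G.dominatorTree s).properDescendants u ↔ G.Dominates s u c :=
    ⟨fun h => ((mem_properDescendants_dominatorTree hG).1 (h hc)).1, fun h x hx =>
      (mem_properDescendants_dominatorTree hG).2
        ⟨hC.dominates_of_dominates huC hc hx h, hne hx⟩⟩
  have hsubR : C ⊆ (G.reverse.dominatorTree s).properDescendants u ↔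
      G.reverse.Dominates s u c :=
    ⟨fun h => ((mem_properDescendants_dominatorTree hGR).1 (h hc)).1, fun h x hx =>
      (mem_properDescendants_dominatorTree hGR).2
        ⟨hCR.dominates_of_dominates huC hc hx h, hne hx⟩⟩
  have hdisj : ¬ G.Dominates s u c →
      Disjoint C ((G.dominatorTree s).properDescendants u) := fun h =>
    Set.disjoint_left.2 fun x hx hxu => h (hC.dominates_of_dominates huC hx hc
      ((mem_properDescendants_dominatorTree hG).1 hxu).1)
  have hdisjR : ¬ G.reverse.Dominates s u c →
      Disjoint C ((G.reverse.dominatorTree s).properDescendants u) := fun h =>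
    Set.disjoint_left.2 fun x hx hxu => h (hCR.dominates_of_dominates huC hx hc
      ((mem_properDescendants_dominatorTree hGR).1 hxu).1)
  -- If `u` dominates `c` in neither direction, then `C` is the component of `s`.
  have hneither : ¬ G.Dominates s u c → ¬ G.reverse.Dominates s u c →
      C = ({v | G.Dominates s u v} ∪ {v | G.reverse.Dominates s u v})ᶜ := by
    intro h hR
    have hsC : s ∈ C := by
      rw [hCdef, hC'.image_eq_mutuallyReachable hc]
      exact ⟨not_dominates_reverse_iff.1 hR, not_dominates_iff.1 h⟩
    rw [hCdef, hC'.image_eq_mutuallyReachable hsC]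
    ext x
    simp only [mutuallyReachable, Set.mem_ofPred_eq, Set.mem_compl_iff, Set.mem_union, not_or,
      not_dominates_iff, reachesWithin_reverse]
  refine ⟨?_, ?_, ?_, ?_, ?_, ?_, ?_⟩
  · by_cases hus : u = s
    · exact .inr (.inr (.inr hus))
    · have := hu.isNontrivialDominator hG hus
      tauto
  · rintro ⟨_, -, hus, -⟩ hnR
    by_cases h : G.Dominates s u c
    · exact .inl (hsub.2 h)
    · have hR : ∀ x, G.reverse.Dominates s u x → G.Dominates s u x := fun x hx =>
        eq_of_dominates_of_not_isNontrivialDominator hnR hus hx ▸ dominates_refl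
      right
      exact (hneither h fun hc => h (hR c hc)).trans
        (congrArg compl (Set.union_eq_self_of_subset_right hR))
  · rintro ⟨_, -, hus, -⟩ hn
    by_cases h : G.reverse.Dominates s u c
    · exact .inl (hsubR.2 h)
    · have hR : ∀ x, G.Dominates s u x → G.reverse.Dominates s u x := fun x hx =>
        eq_of_dominates_of_not_isNontrivialDominator hn hus hx ▸ dominates_refl
      right
      exact (hneither (fun hc => h (hR c hc)) h).trans
        (congrArg compl (Set.union_eq_self_of_subset_left hR))
  · intro _ _
    by_cases h : G.Dominates s u c <;> by_cases hR : G.reverse.Dominates s u c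
    · exact .inr (.inr (.inl (Set.subset_inter (hsub.2 h) (hsubR.2 hR))))
    · exact .inl (Set.subset_sdiff.2 ⟨hsub.2 h, hdisjR hR⟩)
    · exact .inr (.inl (Set.subset_sdiff.2 ⟨hsubR.2 hR, hdisj h⟩))
    · exact .inr (.inr (.inr (hneither h hR)))
  · rintro rfl
    exact hsub.2 dominates_start
  · exact hT.exists_eq_descendants_loopNestingForest hG hC hmax
  · exact hTR.exists_eq_descendants_loopNestingForest hGR hCR hmaxR
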